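/- Let $\mathcal S=\mathcal S(\mathbb R,\mathbb C)$ be the space of complex-valued Schwartz functions of $x\in\mathbb R$, regarded as a real vector space, and let $D_x$ be differentiation, $D_x^{-1}g(x)=\int_{-\infty}^x g(y)\,dy$, and $\Delta=1-D_x^2$, which is invertible on $\mathcal S$. Let $s\in\{1,-1\}$. For $v\in\mathcal S$ define the real-linear operators on $\mathcal S$ $$\mathcal R=\mathcal R_v=s\,i\,(D_x+v\,D_x^{-1}\,\mathrm{Re}\,\bar v)\quad\text{(the NLS recursion operator)},$$ $$\tilde{\mathcal R}=\tilde{\mathcal R}_v=D_x v D_x^{-1}\,\mathrm{Re}\,\bar v\,\Delta^{-1}+i\,v D_x^{-1}\,\mathrm{Im}\,\bar v\, D_x\Delta^{-1}\quad\text{(the peakon recursion operator)},$$ $$\hat{\mathcal R}=\hat{\mathcal R}_v=-(\mathcal R^2+1)\Delta^{-1},$$ where $(\mathrm{Re}\,\bar v)f=\mathrm{Re}(\bar v f)$ and $(\mathrm{Im}\,\bar v)f=\mathrm{Im}(\bar v f)$. Then the following hold. 1. For every $v\in\mathcal S$, $\;-(\mathcal R^2+1)=(\tilde{\mathcal R}-1)\Delta$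 as operators on $\mathcal S$. 2. $\hat{\mathcal R}$ is hereditary: for every differentiable vector field $\eta:\mathcal S\to\mathcal S$ (directional derivatives in the topology of $\mathcal S$, written $\eta'$), the derivatives of $v\mapsto\hat{\mathcal R}_v w$ (for fixed $w\in\mathcal S$) and of $\hat{\mathcal R}\eta: v\mapsto \hat{\mathcal R}_v\eta(v)$ exist, and $$\mathcal L_{X_{\hat{\mathcal R}\eta}}\hat{\mathcal R}=\hat{\mathcal R}\,(\mathcal L_{X_\eta}\hat{\mathcal R}),$$ where $\mathcal L_{X_\eta}\hat{\mathcal R}=\mathrm{pr}X_\eta(\hat{\mathcal R})+[\hat{\mathcal R},\eta']$ and $\mathrm{pr}X_\eta(\hat{\mathcal R})$ is the derivative of $v\mapsto\hat{\mathcal R}_v$ in the direction $\eta(v)$. 3. Let $u\in\mathcal S$ and $v=\Delta u$, and put $A=\tfrac12(|u|^2-|u_x|^2)$, $B=\mathrm{Im}(\bar u u_x)$. Applied to the NLS root flows $P^{(0)}=s\,i\,v$ and $P^{(1)}=-v_x$, the operator $\hat{\mathcal R}=\hat{\mathcal R}_v$ gives $$\hat{\mathcal R}(s\,i\,v)=\tilde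 P^{(0,1)}-P^{(0)},\qquad \tilde P^{(0,1)}=s\,i\big(Av+i(Bv)_x\big),$$ $$\hat{\mathcal R}(-v_x)=\tilde P^{(1,1)}-P^{(1)},\qquad \tilde P^{(1,1)}=-(Av)_x-iBv .$$ 4. Let $J\subseteq\mathbb R$ be open and let $u(t,\cdot)\in\mathcal S$ for all $t$, with $v=\Delta u$. Call $u$ a solution on $J$ of a flow equation for $v_t$ if $v$ is $C^1$ on $J\times\mathbb R$ and satisfies the equation there pointwise. (a) $u(t,x)$ is a solution on $J$ of the NLS-type peakon equation $v_t=\tilde P^{(0,1)}$ if and only if its phase rotation $e^{-s i t}u(t,x)$ is a solution on $J$ of $v_t=\hat{\mathcal R}(s\,i\,v)$. (b) $u(t,x)$ is a solution on $J$ of the Hirota-type peakon equation $v_t=\tilde P^{(1,1)}$ if and only if its Galilean transform $u(t,x+t)$ is a solution on $J$ of $v_t=\hat{\mathcal R}(-v_x)$. -/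

import Mathlib

open scoped SchwartzMap ContDiff Topology ComplexConjugate
open MeasureTheory Filter

noncomputable section

namespace PeakonNLS

/-! ### The phase space and the basic operators

The dynamical variable `v` is a complex-valued Schwartz function of `x ∈ ℝ`.  All operators are
real-linear operators on this space (real and imaginary parts are taken, so they are not
complex-linear). -/

/-- The space of complex-valued Schwartz functions on the line. -/
abbrev Phase : Type := 𝓢(ℝ, ℂ)

/-- The total derivative `D_x`. -/
def Dx : Module.End ℝ Phase := (SchwartzMap.derivCLM ℝ ℂ : Phase →L[ℝ] Phase).toLinearMap

theorem Dx_apply (f : Phase) (x : ℝ) : Dx f x = deriv f x := rfl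

/-- `Δ = 1 - D_x²`. -/
def Delta : Module.End ℝ Phase := 1 - Dx ^ 2

/-- The symbol `(1 + (2πξ)²)⁻¹` of `Δ⁻¹`, for the Fourier transform with kernel `e^{-2πixξ}`. -/
def invSymbol (ξ : ℝ) : ℝ := (1 + (2 * Real.pi * ξ) ^ 2)⁻¹

/-- `Δ⁻¹`, the two-sided inverse of `Δ` (see `Delta_mul_DeltaInv` and `DeltaInv_mul_Delta`),
given as a Fourier multiplier. -/
def DeltaInv : Module.End ℝ Phase :=
  (SchwartzMap.fourierMultiplierCLM ℂ invSymbol : Phase →L[ℝ] Phase).toLinearMap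

theorem invSymbol_temperate : invSymbol.HasTemperateGrowth := by
  have h := (Function.hasTemperateGrowth_one_add_norm_sq_rpow ℝ (-1)).comp
    (f := fun ξ : ℝ => (2 * Real.pi) * ξ) (by fun_prop)
  have e : invSymbol = (fun x : ℝ => (1 + ‖x‖ ^ 2) ^ (-1 : ℝ)) ∘ fun ξ : ℝ => (2 * Real.pi) * ξ := by
    ext ξ
    simp only [invSymbol, Function.comp, Real.norm_eq_abs, sq_abs]
    rw [Real.rpow_neg_one]
  rw [e]
  exact h

theorem Dx_eq_multiplier (f : Phase) :
    Dx f = (2 * Real.pi * Complex.I) • SchwartzMap.fourierMultiplierCLM ℂ (fun ξ : ℝ => ξ) f := by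
  have h := SchwartzMap.lineDeriv_eq_fourierMultiplierCLM (1 : ℝ) f
  have h2 : (fun x : ℝ => inner ℝ x (1 : ℝ)) = fun ξ => ξ := by ext; simp
  rw [h2] at h
  rw [← h]
  ext x
  simp [Dx_apply, SchwartzMap.lineDerivOp_apply_eq_fderiv]

theorem Delta_eq_multiplier (f : Phase) :
    Delta f = SchwartzMap.fourierMultiplierCLM ℂ (fun ξ : ℝ => 1 + (2 * Real.pi * ξ) ^ 2) f := by
  have hid : (fun ξ : ℝ => ξ).HasTemperateGrowth := by fun_prop
  have hc : (fun _ : ℝ => (1 : ℝ)).HasTemperateGrowth := by fun_prop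
  have hs : (fun ξ : ℝ => (2 * Real.pi * ξ) ^ 2).HasTemperateGrowth := by fun_prop
  have hsum : (fun ξ : ℝ => 1 + (2 * Real.pi * ξ) ^ 2).HasTemperateGrowth := by fun_prop
  have e : ∀ (g : ℝ → ℝ), g.HasTemperateGrowth → ∀ h : Phase,
      SchwartzMap.fourierMultiplierCLM ℂ g h =
        SchwartzMap.fourierMultiplierCLM ℂ (fun x => (g x : ℂ)) h := fun g hg h =>
    (SchwartzMap.fourierMultiplierCLM_ofReal ℂ hg h).symm
  have h1 : Delta f = f - Dx (Dx f) := by simp [Delta, pow_two]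
  rw [h1, Dx_eq_multiplier (Dx f), Dx_eq_multiplier f, e _ hid, e _ hid, map_smul,
    SchwartzMap.fourierMultiplierCLM_fourierMultiplierCLM_apply (by fun_prop) (by fun_prop),
    smul_smul, e _ hsum]
  rw [sub_eq_iff_eq_add]
  simp only [SchwartzMap.fourierMultiplierCLM_apply]
  rw [← FourierTransform.fourierInv_smul, ← FourierTransform.fourierInv_add]
  have hf : f = FourierTransform.fourierInv (FourierTransform.fourier f : Phase) :=
    (FourierTransform.fourierInv_fourier_eq f).symm
  conv_lhs => rw [hf]
  congr 1
  ext x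
  rw [add_apply, smul_apply,
    SchwartzMap.smulLeftCLM_apply_apply (by fun_prop),
    SchwartzMap.smulLeftCLM_apply_apply (by fun_prop)]
  simp only [Pi.mul_apply, smul_eq_mul]
  push_cast
  linear_combination (-(4 * Real.pi ^ 2 * x ^ 2) * (FourierTransform.fourier f) x) * Complex.I_sq

theorem invSymbol_mul :
    invSymbol * (fun ξ : ℝ => 1 + (2 * Real.pi * ξ) ^ 2) = fun _ => 1 := by
  ext ξ
  simp only [invSymbol, Pi.mul_apply]
  exact inv_mul_cancel₀ (by positivity)

theorem Delta_mul_DeltaInv : Delta * DeltaInv = 1 := by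
  ext1 f
  rw [Module.End.mul_apply, Delta_eq_multiplier]
  change SchwartzMap.fourierMultiplierCLM ℂ _ (SchwartzMap.fourierMultiplierCLM ℂ invSymbol f) = f
  rw [SchwartzMap.fourierMultiplierCLM_fourierMultiplierCLM_apply (by fun_prop)
    invSymbol_temperate, mul_comm, invSymbol_mul]
  simp

theorem DeltaInv_mul_Delta : DeltaInv * Delta = 1 := by
  ext1 f
  rw [Module.End.mul_apply, Delta_eq_multiplier]
  change SchwartzMap.fourierMultiplierCLM ℂ invSymbol (SchwartzMap.fourierMultiplierCLM ℂ _ f) = f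
  rw [SchwartzMap.fourierMultiplierCLM_fourierMultiplierCLM_apply
    invSymbol_temperate (by fun_prop), invSymbol_mul]
  simp

/-! ### The nonlocal operators `v D_x⁻¹ Re v̄` and `v D_x⁻¹ Im v̄` -/

/-- The inverse `D_x⁻¹` of the total derivative: the primitive vanishing at `-∞`. -/
def antideriv (g : ℝ → ℝ) (x : ℝ) : ℝ := ∫ y in Set.Iic x, g y

theorem hasDerivAt_antideriv (g : 𝓢(ℝ, ℝ)) (x : ℝ) : HasDerivAt (antideriv g) (g x) x := by
  have h1 : ∀ y, antideriv g y = (∫ z in Set.Iic (0 : ℝ), g z) + ∫ z in (0 : ℝ)..y, g z := by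
    intro y
    have := intervalIntegral.integral_Iic_sub_Iic (μ := volume) (f := g) (a := 0) (b := y)
      g.integrable.integrableOn g.integrable.integrableOn
    simp only [antideriv]
    linarith
  have h2 : HasDerivAt (fun y => ∫ z in (0 : ℝ)..y, g z) (g x) x :=
    (g.continuous).integral_hasStrictDerivAt 0 x |>.hasDerivAt
  rw [show antideriv g = fun y => (∫ z in Set.Iic (0 : ℝ), g z) + ∫ z in (0 : ℝ)..y, g z from
    funext h1]
  exact h2.const_add _

theorem antideriv_temperate (g : 𝓢(ℝ, ℝ)) : (antideriv g).HasTemperateGrowth := by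
  refine Function.HasTemperateGrowth.of_fderiv (k := 0) (C := ∫ y, ‖g y‖) ?_
    (fun x => (hasDerivAt_antideriv g x).differentiableAt) ?_
  · have : fderiv ℝ (antideriv g) =
        (ContinuousLinearMap.toSpanSingletonCLE : ℝ ≃L[ℝ] (ℝ →L[ℝ] ℝ)) ∘ g := by
      ext1 x
      exact (hasDerivAt_antideriv g x).hasFDerivAt.fderiv
    rw [this]
    exact (ContinuousLinearEquiv.hasTemperateGrowth _).comp g.hasTemperateGrowth
  · intro x
    rw [pow_zero, mul_one]
    exact (norm_integral_le_integral_norm _).trans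
      (setIntegral_le_integral g.integrable.norm (ae_of_all _ fun _ => norm_nonneg _))

/-- For a real-linear functional `L` on `ℂ`, the Schwartz function `L(v̄ f)`. -/
def density (L : ℂ →L[ℝ] ℝ) (v f : Phase) : 𝓢(ℝ, ℝ) :=
  SchwartzMap.postcompCLM (𝕜 := ℝ) L
    (SchwartzMap.pairing (ContinuousLinearMap.mul ℝ ℂ)
      (SchwartzMap.postcompCLM (𝕜 := ℝ) (Complex.conjCLE : ℂ →L[ℝ] ℂ) v) f)

theorem density_apply (L : ℂ →L[ℝ] ℝ) (v f : Phase) (x : ℝ) :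
    density L v f x = L (conj (v x) * f x) := by
  simp [density]

/-- `nonlocal L v` is the operator `f ↦ v D_x⁻¹ L(v̄ f)`. -/
def nonlocal (L : ℂ →L[ℝ] ℝ) (v : Phase) : Module.End ℝ Phase where
  toFun f := SchwartzMap.smulLeftCLM ℂ (antideriv (density L v f)) v
  map_add' f g := by
    ext x
    simp only [add_apply, SchwartzMap.smulLeftCLM_apply_apply (antideriv_temperate _)]
    rw [← add_smul]
    congr 1
    simp only [antideriv]
    rw [← integral_add (density L v f).integrable.integrableOn
      (density L v g).integrable.integrableOn]
    congr 1
    ext y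
    simp [density_apply, mul_add]
  map_smul' c f := by
    ext x
    simp only [smul_apply, SchwartzMap.smulLeftCLM_apply_apply (antideriv_temperate _),
      RingHom.id_apply]
    rw [smul_smul]
    congr 1
    simp only [antideriv]
    rw [← integral_const_mul]
    congr 1
    ext y
    rw [density_apply, density_apply, smul_apply, mul_smul_comm, map_smul, smul_eq_mul]

theorem nonlocal_apply (L : ℂ →L[ℝ] ℝ) (v f : Phase) (x : ℝ) :
    nonlocal L v f x = v x * (antideriv (fun y => L (conj (v y) * f y)) x : ℝ) := by
  change SchwartzMap.smulLeftCLM ℂ (antideriv (density L v f)) v x = _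
  rw [SchwartzMap.smulLeftCLM_apply_apply (antideriv_temperate _), Complex.real_smul, mul_comm]
  congr 3

/-! ### Recursion operators -/

/-- The NLS recursion operator `R = s i (D_x + v D_x⁻¹ Re v̄)` at the point `v`. -/
def nlsR (s : ℝ) (v : Phase) : Module.End ℝ Phase :=
  ((s : ℂ) * Complex.I) • (Dx + nonlocal Complex.reCLM v)

/-- The peakon recursion operator
`R̃ = D_x v D_x⁻¹ Re v̄ Δ⁻¹ + i v D_x⁻¹ Im v̄ D_x Δ⁻¹` at the point `v`. -/
def peakonR (v : Phase) : Module.End ℝ Phase :=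
  Dx * nonlocal Complex.reCLM v * DeltaInv
    + Complex.I • (nonlocal Complex.imCLM v * Dx * DeltaInv)

/-- The shifted operator `R̂ = -(R² + 1) Δ⁻¹` at the point `v`. -/
def hatR (s : ℝ) (v : Phase) : Module.End ℝ Phase :=
  -(nlsR s v ^ 2 + 1) * DeltaInv

/-! ### Lie derivatives and the hereditary property -/

section Hereditary

variable {E : Type*} [AddCommGroup E] [Module ℝ E] [TopologicalSpace E]

/-- `F` has derivative `F'` at the point `v` in the direction `w`. -/
def HasDirDeriv (F : E → E) (F' v w : E) : Prop :=
  Tendsto (fun t : ℝ => t⁻¹ • (F (v + t • w) - F v)) (𝓝[≠] 0) (𝓝 F')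

/-- `η' v w` is the (directional) Frechet derivative of the vector field `η` at `v`, applied to
`w`.  Only directional derivatives are asked for, so that every differential function
`η(x, v, v_x, …)` which acts as a differentiable map of the phase space is covered. -/
def IsFrechetDeriv (η : E → E) (η' : E → E → E) : Prop :=
  ∀ v w, HasDirDeriv η (η' v w) v w

/-- `R' v a w` is the derivative at `v`, in the direction `a`, of the operator field `R`
applied to the fixed vector `w`. -/
def IsOperatorDeriv (R : E → Module.End ℝ E) (R' : E → E → E → E) : Prop :=
  ∀ v a w, HasDirDeriv (fun q => R q w) (R' v a w) v a

/-- The Lie derivative `L_{X_η} R = pr X_η (R) + [R, η']` of the operator field `R` (with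
derivative `R'`) along the vector field `η` (with Frechet derivative `η'`), at the point `v`,
applied to `w`. -/
def lieDeriv (R : E → Module.End ℝ E) (R' : E → E → E → E) (η : E → E) (η' : E → E → E)
    (v w : E) : E :=
  R' v (η v) w + (R v (η' v w) - η' v (R v w))

/-- The hereditary property `L_{X_{Rη}} R = R (L_{X_η} R)` for all differentiable vector
fields `η`; it includes the existence of all derivatives that occur in it. -/
def IsHereditary (R : E → Module.End ℝ E) : Prop :=
  ∃ R', IsOperatorDeriv R R' ∧
    ∀ η η', IsFrechetDeriv η η' →
      ∃ Rη', IsFrechetDeriv (fun v => R v (η v)) Rη' ∧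
        ∀ v w, lieDeriv R R' (fun q => R q (η q)) Rη' v w = R v (lieDeriv R R' η η' v w)

end Hereditary

/-! ### Root flows, peakon flows, and solutions -/

/-- The even root flow `P⁽⁰⁾ = s i v`. -/
def rootEven (s : ℝ) (v : Phase) : Phase := ((s : ℂ) * Complex.I) • v

/-- The odd root flow `P⁽¹⁾ = -v_x`. -/
def rootOdd (v : Phase) : Phase := -Dx v

/-- `A = (|u|² - |u_x|²) / 2`. -/
def potA (u : Phase) (x : ℝ) : ℝ := (‖u x‖ ^ 2 - ‖Dx u x‖ ^ 2) / 2

/-- `B = Im (ū u_x)`. -/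
def potB (u : Phase) (x : ℝ) : ℝ := (conj (u x) * Dx u x).im

/-- The NLS-type peakon flow `s i (A v + i (B v)_x)`, where `v = Δ u`. -/
def evenPeakonFlow (s : ℝ) (u : Phase) (x : ℝ) : ℂ :=
  (s : ℂ) * Complex.I *
    (potA u x * Delta u x + Complex.I * deriv (fun y => (potB u y : ℂ) * Delta u y) x)

/-- The Hirota-type peakon flow `-(A v)_x - i B v`, where `v = Δ u`. -/
def oddPeakonFlow (u : Phase) (x : ℝ) : ℂ :=
  -deriv (fun y => (potA u y : ℂ) * Delta u y) x - Complex.I * potB u x * Delta u x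

/-- `u` is a classical solution, on the time set `J`, of the flow equation `v_t = F[u]` with
`v = Δ u`: the function `v(t,x)` is continuously differentiable on `J × ℝ` and satisfies the
equation at every point. -/
def IsSolution (J : Set ℝ) (F : Phase → ℝ → ℂ) (u : ℝ → Phase) : Prop :=
  ContDiffOn ℝ 1 (fun p : ℝ × ℝ => Delta (u p.1) p.2) (J ×ˢ Set.univ) ∧
    ∀ t ∈ J, ∀ x, HasDerivAt (fun τ => Delta (u τ) x) (F (u t) x) t

end PeakonNLS

end

open PeakonNLS

noncomputable section

namespace PeakonNLS

/-! ### Primitives of Schwartz functions -/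

/-! The NLS operator squares to a local-plus-nonlocal expression because multiplication by `i`
exchanges `Re v̄` and `-Im v̄`, and because `Re(v̄ i v r) = 0` for real `r`. This gives the
factorisation `neg_nlsR_sq_add_one`, whence `R̂ = R̃ - 1`.

Heredity is the vanishing of the Nijenhuis torsion: in the two Lie derivatives every term with `η'`
cancels, and what is left is the symmetry `peakonRDeriv_hatR_symm`. The shift by `1` does not affect
the torsion, so it suffices to treat `R̃`. Writing the arguments as `Δp` and `Δq` removes `Δ⁻¹`. The
antisymmetrised derivative of `R̃` is then `Δ` of an explicit `bracket v p q`
(`peakonRDeriv_antisymm`), and the same expression with directions `R̃Δp`, `R̃Δq` is `R̃Δ` of that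
bracket (`peakonRDeriv_peakonR_antisymm`). Both rest on one device: certain combinations of
densities are exact derivatives, so their primitives are local, and the rest is pointwise algebra.
The derivatives themselves exist because `twist` is trilinear and continuous in its last argument
(`continuous_twist`).

For `v = Δu` the densities `Im(v̄u)`, `Re(v̄u_x)`, `Im(v̄u_xx)` equal `B_x`, `A_x`, `B_x`, so the
root flows become local. The subtracted root flow is the generator of a phase rotation or a
translation. Both commute with the flows, so a moving frame absorbs it. -/

theorem antideriv_add (g h : 𝓢(ℝ, ℝ)) (x : ℝ) :
    antideriv (g + h : 𝓢(ℝ, ℝ)) x = antideriv g x + antideriv h x :=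
  integral_add g.integrable.integrableOn h.integrable.integrableOn

theorem antideriv_sub (g h : 𝓢(ℝ, ℝ)) (x : ℝ) :
    antideriv (g - h : 𝓢(ℝ, ℝ)) x = antideriv g x - antideriv h x :=
  integral_sub g.integrable.integrableOn h.integrable.integrableOn

theorem antideriv_neg (g : 𝓢(ℝ, ℝ)) (x : ℝ) :
    antideriv (-g : 𝓢(ℝ, ℝ)) x = -antideriv g x :=
  integral_neg _

theorem antideriv_smul (c : ℝ) (g : 𝓢(ℝ, ℝ)) (x : ℝ) :
    antideriv (c • g : 𝓢(ℝ, ℝ)) x = c * antideriv g x :=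
  integral_const_mul _ _

/-- There is no constant of integration, since a Schwartz function vanishes at `-∞`. -/
theorem antideriv_derivCLM (g : 𝓢(ℝ, ℝ)) (x : ℝ) :
    antideriv (SchwartzMap.derivCLM ℝ ℝ g) x = g x := by
  have h := integral_Iic_of_hasDerivAt_of_tendsto' (a := x) (f := g)
    (f' := SchwartzMap.derivCLM ℝ ℝ g) (m := 0) (fun y _ => g.hasDerivAt y)
    (SchwartzMap.derivCLM ℝ ℝ g).integrable.integrableOn
    ((SchwartzMap.tendsto_cocompact g).mono_left (by
      rw [cocompact_eq_atBot_atTop]; exact le_sup_left))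
  rw [sub_zero] at h
  exact h

theorem abs_antideriv_le (g : 𝓢(ℝ, ℝ)) (x : ℝ) : |antideriv g x| ≤ ∫ y, ‖g y‖ :=
  (norm_integral_le_integral_norm _).trans
    (setIntegral_le_integral g.integrable.norm (ae_of_all _ fun _ => norm_nonneg _))

/-! ### The density -/

theorem density_add_left (L : ℂ →L[ℝ] ℝ) (b c f : Phase) :
    density L (b + c) f = density L b f + density L c f := by
  ext x; simp [density_apply, add_mul]

theorem density_smul_left (L : ℂ →L[ℝ] ℝ) (t : ℝ) (b f : Phase) :
    density L (t • b) f = t • density L b f := by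
  ext x
  rw [smul_apply, density_apply, density_apply, smul_apply, ← Complex.conjCLE_apply, map_smul,
    smul_mul_assoc, map_smul]
  rfl

theorem density_add_right (L : ℂ →L[ℝ] ℝ) (b f g : Phase) :
    density L b (f + g) = density L b f + density L b g := by
  ext x; simp [density_apply, mul_add]

theorem density_sub_right (L : ℂ →L[ℝ] ℝ) (b f g : Phase) :
    density L b (f - g) = density L b f - density L b g := by
  ext x; simp [density_apply, mul_sub]

theorem density_smul_right (L : ℂ →L[ℝ] ℝ) (t : ℝ) (b f : Phase) :
    density L b (t • f) = t • density L b f := by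
  ext x; simp only [density_apply, smul_apply, mul_smul_comm, map_smul]

theorem derivCLM_density (L : ℂ →L[ℝ] ℝ) (b f : Phase) :
    SchwartzMap.derivCLM ℝ ℝ (density L b f) = density L (Dx b) f + density L b (Dx f) := by
  ext x
  rw [SchwartzMap.derivCLM_apply]
  have hb : HasDerivAt (fun y => conj (b y)) (conj (deriv b x)) x := (b.hasDerivAt x).star
  have h2 := (L.hasFDerivAt (x := conj (b x) * f x)).comp_hasDerivAt x (hb.mul (f.hasDerivAt x))
  have e : (density L b f : ℝ → ℝ) = fun y => L (conj (b y) * f y) := by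
    ext y; exact density_apply L b f y
  rw [e]
  refine h2.deriv.trans ?_
  rw [map_add, add_apply, density_apply, density_apply]
  rfl

/-! ### The polarised nonlocal operator -/

/-- The trilinear map `(a, b, f) ↦ a D_x⁻¹ L(b̄ f)` which polarises `nonlocal L`. -/
def twist (L : ℂ →L[ℝ] ℝ) (a b f : Phase) : Phase :=
  SchwartzMap.smulLeftCLM ℂ (antideriv (density L b f)) a

/-- The trilinear map `(a, b, f) ↦ a L(b̄ f)`. -/
def triple (L : ℂ →L[ℝ] ℝ) (a b f : Phase) : Phase :=
  SchwartzMap.pairing (ContinuousLinearMap.lsmul ℝ ℝ : ℝ →L[ℝ] ℂ →L[ℝ] ℂ) (density L b f) a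

theorem twist_apply (L : ℂ →L[ℝ] ℝ) (a b f : Phase) (x : ℝ) :
    twist L a b f x = antideriv (density L b f) x * a x := by
  rw [twist, SchwartzMap.smulLeftCLM_apply_apply (antideriv_temperate _), Complex.real_smul]

theorem triple_apply (L : ℂ →L[ℝ] ℝ) (a b f : Phase) (x : ℝ) :
    triple L a b f x = (L (conj (b x) * f x) : ℝ) * a x := by
  simp [triple, density_apply]

/-- Product rule: the derivative that falls on the primitive leaves a local term, and the other
keeps the nonlocal shape with a new prefactor. -/
theorem Dx_twist (L : ℂ →L[ℝ] ℝ) (a b f : Phase) :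
    Dx (twist L a b f) = twist L (Dx a) b f + triple L a b f := by
  ext x
  have e : (twist L a b f : ℝ → ℂ) = fun y => (antideriv (density L b f) y : ℂ) * a y := by
    ext y; exact twist_apply L a b f y
  rw [Dx_apply, e]
  have h := ((hasDerivAt_antideriv (density L b f) x).ofReal_comp).mul (a.hasDerivAt x)
  refine h.deriv.trans ?_
  rw [add_apply, twist_apply, triple_apply, Dx_apply, density_apply]
  ring

theorem Dx_triple (L : ℂ →L[ℝ] ℝ) (a b f : Phase) :
    Dx (triple L a b f) =
      triple L (Dx a) b f + triple L a (Dx b) f + triple L a b (Dx f) := by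
  ext x
  have e : (triple L a b f : ℝ → ℂ) = fun y => (density L b f y : ℂ) * a y := by
    ext y; rw [triple_apply, density_apply]
  rw [Dx_apply, e]
  have h := (((density L b f).hasDerivAt x).ofReal_comp).mul (a.hasDerivAt x)
  refine h.deriv.trans ?_
  have h2 := congrArg (fun g : 𝓢(ℝ, ℝ) => g x) (derivCLM_density L b f)
  simp only [SchwartzMap.derivCLM_apply, add_apply, density_apply] at h2
  simp only [add_apply, triple_apply, h2, density_apply, Dx_apply]
  push_cast
  ring

theorem twist_add₁ (L : ℂ →L[ℝ] ℝ) (a a' b f : Phase) :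
    twist L (a + a') b f = twist L a b f + twist L a' b f := map_add _ _ _

theorem twist_smul₁ (L : ℂ →L[ℝ] ℝ) (t : ℝ) (a b f : Phase) :
    twist L (t • a) b f = t • twist L a b f := map_smul _ _ _

theorem twist_add₂ (L : ℂ →L[ℝ] ℝ) (a b b' f : Phase) :
    twist L a (b + b') f = twist L a b f + twist L a b' f := by
  ext x
  simp only [add_apply, twist_apply, density_add_left, antideriv_add]
  push_cast; ring

theorem twist_smul₂ (L : ℂ →L[ℝ] ℝ) (t : ℝ) (a b f : Phase) :
    twist L a (t • b) f = t • twist L a b f := by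
  ext x
  simp only [smul_apply, twist_apply, density_smul_left, antideriv_smul, Complex.real_smul]
  push_cast; ring

theorem twist_add₃ (L : ℂ →L[ℝ] ℝ) (a b f f' : Phase) :
    twist L a b (f + f') = twist L a b f + twist L a b f' := by
  ext x
  simp only [add_apply, twist_apply, density_add_right, antideriv_add]
  push_cast; ring

theorem twist_sub₃ (L : ℂ →L[ℝ] ℝ) (a b f f' : Phase) :
    twist L a b (f - f') = twist L a b f - twist L a b f' := by
  ext x
  simp only [sub_apply, twist_apply, density_sub_right, antideriv_sub]
  push_cast; ring

theorem twist_smul₃ (L : ℂ →L[ℝ] ℝ) (t : ℝ) (a b f : Phase) :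
    twist L a b (t • f) = t • twist L a b f := by
  ext x
  simp only [smul_apply, twist_apply, density_smul_right, antideriv_smul, Complex.real_smul]
  push_cast; ring

/-- `twist L a b` as a linear map. -/
def twistLin (L : ℂ →L[ℝ] ℝ) (a b : Phase) : Module.End ℝ Phase where
  toFun := twist L a b
  map_add' := twist_add₃ L a b
  map_smul' t := twist_smul₃ L t a b

/-! ### Continuity of the nonlocal operator -/

/-- Trades one order of differentiation for `Dx`, so that seminorm bounds can be proved by induction
through `Dx_twist`. -/
theorem seminorm_succ_eq_seminorm_Dx (k n : ℕ) (f : Phase) :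
    SchwartzMap.seminorm ℝ k (n + 1) f = SchwartzMap.seminorm ℝ k n (Dx f) := by
  have e : ∀ x, ‖iteratedFDeriv ℝ (n + 1) f x‖ = ‖iteratedFDeriv ℝ n (Dx f) x‖ := by
    intro x
    rw [norm_iteratedFDeriv_eq_norm_iteratedDeriv, norm_iteratedFDeriv_eq_norm_iteratedDeriv,
      iteratedDeriv_succ']
    rfl
  apply le_antisymm
  · refine SchwartzMap.seminorm_le_bound ℝ k _ f (apply_nonneg _ _) fun x => ?_
    rw [e]
    exact SchwartzMap.le_seminorm ℝ k n (Dx f) x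
  · refine SchwartzMap.seminorm_le_bound ℝ k _ _ (apply_nonneg _ _) fun x => ?_
    rw [← e]
    exact SchwartzMap.le_seminorm ℝ k (n + 1) f x

theorem continuous_density (L : ℂ →L[ℝ] ℝ) (b : Phase) : Continuous (density L b) := by
  unfold density
  fun_prop

theorem continuous_triple (L : ℂ →L[ℝ] ℝ) (a b : Phase) : Continuous (triple L a b) :=
  (SchwartzMap.pairing_continuous_left _ a).comp (continuous_density L b)

theorem continuous_Dx : Continuous Dx := (SchwartzMap.derivCLM ℝ ℂ : Phase →L[ℝ] Phase).continuous

theorem continuous_integral_norm_density (L : ℂ →L[ℝ] ℝ) (b : Phase) :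
    Continuous fun f => ∫ y, ‖density L b f y‖ := by
  have h : Continuous fun f => ‖(density L b f).toLp 1 volume‖ :=
    (SchwartzMap.continuous_toLp.comp (continuous_density L b)).norm
  simpa only [SchwartzMap.norm_toLp_one] using h

theorem continuous_twist (L : ℂ →L[ℝ] ℝ) (a b : Phase) : Continuous (twist L a b) := by
  change Continuous (twistLin L a b)
  refine continuous_of_continuousAt_zero (twistLin L a b) ?_
  rw [ContinuousAt, map_zero, (schwartz_withSeminorms ℝ ℝ ℂ).tendsto_nhds]
  rintro ⟨k, n⟩ ε hε
  -- The prefactor `a` varies in the induction because `Dx_twist` replaces it by `Dx a`. At order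
  -- zero the primitive is bounded by the `L¹` norm of the density, which is continuous in `f`.
  have key : ∀ n (a : Phase), Tendsto (fun f => SchwartzMap.seminorm ℝ k n (twist L a b f))
      (𝓝 0) (𝓝 0) := by
    intro n
    induction n with
    | zero =>
      intro a
      refine squeeze_zero (g := fun f => (∫ y, ‖density L b f y‖) * SchwartzMap.seminorm ℝ k 0 a)
        (fun f => apply_nonneg _ _) (fun f => ?_) ?_
      · refine SchwartzMap.seminorm_le_bound ℝ k 0 _ (by positivity) fun x => ?_
        rw [norm_iteratedFDeriv_zero, twist_apply, norm_mul, Complex.norm_real]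
        have h1 := abs_antideriv_le (density L b f) x
        have h2 := SchwartzMap.norm_pow_mul_le_seminorm ℝ a k x
        calc ‖x‖ ^ k * (‖antideriv (density L b f) x‖ * ‖a x‖)
            = ‖antideriv (density L b f) x‖ * (‖x‖ ^ k * ‖a x‖) := by ring
          _ ≤ _ := by gcongr; exact h1
      · have h := ((continuous_integral_norm_density L b).tendsto 0).mul_const
          (SchwartzMap.seminorm ℝ k 0 a)
        have e : density L b 0 = 0 := by ext x; simp [density_apply]
        simpa [e] using h
    | succ n ih =>
      intro a
      refine squeeze_zero (g := fun f => SchwartzMap.seminorm ℝ k n (twist L (Dx a) b f) +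
        SchwartzMap.seminorm ℝ k n (triple L a b f)) (fun f => apply_nonneg _ _) (fun f => ?_) ?_
      · rw [seminorm_succ_eq_seminorm_Dx, Dx_twist]
        exact map_add_le_add _ _ _
      · have h : Tendsto (fun f => SchwartzMap.seminorm ℝ k n (triple L a b f)) (𝓝 0) (𝓝 0) := by
          have h1 := (((schwartz_withSeminorms ℝ ℝ ℂ).continuous_seminorm (k, n)).comp
            (continuous_triple L a b)).tendsto 0
          have e : triple L a b 0 = 0 := by ext x; simp [triple_apply]
          simpa [e, SchwartzMap.schwartzSeminormFamily_apply, Function.comp_def] using h1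
        simpa using (ih (Dx a)).add h
  have := (key n a).eventually (gt_mem_nhds hε)
  filter_upwards [this] with f hf
  simpa [SchwartzMap.schwartzSeminormFamily_apply, twistLin] using hf

/-! ### Elementary identities for `Δ`, `Δ⁻¹` and `R̃` -/

theorem Delta_apply (f : Phase) : Delta f = f - Dx (Dx f) := by
  simp [Delta, pow_two]

theorem Delta_DeltaInv (f : Phase) : Delta (DeltaInv f) = f :=
  congrArg (fun T : Module.End ℝ Phase => T f) Delta_mul_DeltaInv

theorem DeltaInv_Delta (f : Phase) : DeltaInv (Delta f) = f :=
  congrArg (fun T : Module.End ℝ Phase => T f) DeltaInv_mul_Delta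

theorem Dx_complex_smul (c : ℂ) (f : Phase) : Dx (c • f) = c • Dx f := by
  ext x
  exact deriv_const_smul c f.differentiableAt

theorem peakonR_apply (v b : Phase) :
    peakonR v b = Dx (twist Complex.reCLM v v (DeltaInv b)) +
      Complex.I • twist Complex.imCLM v v (Dx (DeltaInv b)) := rfl

/-! ### The factorisation of `R² + 1` -/

theorem density_re_I_smul (v f : Phase) :
    density Complex.reCLM v (Complex.I • f) = -density Complex.imCLM v f := by
  ext x
  simp [density_apply]
  ring

theorem density_re_I_smul_twist (L : ℂ →L[ℝ] ℝ) (v f : Phase) :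
    density Complex.reCLM v (Complex.I • twist L v v f) = 0 := by
  ext x
  simp [density_apply, twist_apply]
  ring

theorem neg_nlsR_sq_add_one {s : ℝ} (hs : s = 1 ∨ s = -1) (v : Phase) :
    -(nlsR s v ^ 2 + 1) = (peakonR v - 1) * Delta := by
  have key : ∀ f, (nlsR s v) f = s • Complex.I • (Dx f + twist Complex.reCLM v v f) := by
    intro f
    ext x
    change ((s : ℂ) * Complex.I) * _ = s • (Complex.I * _)
    rw [Complex.real_smul, mul_assoc]
    rfl
  have hss : s * s = 1 := by rcases hs with h | h <;> simp [h]
  have h1 : ∀ f, twist Complex.reCLM v v (Complex.I • f) = -twist Complex.imCLM v v f := by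
    intro f
    ext x
    rw [twist_apply, density_re_I_smul, antideriv_neg, neg_apply, twist_apply, Complex.ofReal_neg,
      neg_mul]
  have h2 : ∀ f, twist Complex.reCLM v v (Complex.I • twist Complex.reCLM v v f) = 0 := by
    intro f
    ext x
    have : antideriv (0 : 𝓢(ℝ, ℝ)) x = 0 := by simp [antideriv]
    rw [twist_apply, density_re_I_smul_twist, this]
    simp
  ext1 f
  rw [LinearMap.neg_apply, LinearMap.add_apply, Module.End.one_apply, pow_two,
    Module.End.mul_apply, key, key, Module.End.mul_apply, LinearMap.sub_apply, peakonR_apply,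
    Module.End.one_apply, DeltaInv_Delta, Delta_apply, map_smul, twist_smul₃, ← smul_add,
    smul_comm Complex.I s, smul_smul, hss, one_smul, Dx_complex_smul, map_add, smul_add Complex.I (Dx f),
    twist_add₃, h1, h2, add_zero, smul_add, smul_smul, Complex.I_mul_I, neg_smul, one_smul,
    smul_neg]
  abel

theorem hatR_eq {s : ℝ} (hs : s = 1 ∨ s = -1) (v : Phase) : hatR s v = peakonR v - 1 := by
  rw [hatR, neg_nlsR_sq_add_one hs, mul_assoc, Delta_mul_DeltaInv, mul_one]

theorem hatR_apply {s : ℝ} (hs : s = 1 ∨ s = -1) (v b : Phase) :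
    hatR s v b = peakonR v b - b := by
  rw [hatR_eq hs]; rfl

/-! ### Directional derivatives of the recursion operator -/

/-- The derivative of `v ↦ R̃_v b` in the direction `c`. -/
def peakonRDeriv (v c b : Phase) : Phase :=
  Dx (twist Complex.reCLM c v (DeltaInv b) + twist Complex.reCLM v c (DeltaInv b)) +
    Complex.I • (twist Complex.imCLM c v (Dx (DeltaInv b)) +
      twist Complex.imCLM v c (Dx (DeltaInv b)))

theorem continuous_DeltaInv : Continuous DeltaInv :=
  (SchwartzMap.fourierMultiplierCLM ℂ invSymbol : Phase →L[ℝ] Phase).continuous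

theorem HasDirDeriv.clm_comp {E : Type*} [AddCommGroup E] [Module ℝ E] [TopologicalSpace E]
    {F : E → E} {F' v w : E} (h : HasDirDeriv F F' v w) (T : E →ₗ[ℝ] E) (hT : Continuous T) :
    HasDirDeriv (fun q => T (F q)) (T F') v w := by
  have := (hT.tendsto F').comp h
  refine this.congr fun t => ?_
  simp

/-- Differentiability along a line gives continuity along it: the increment is `t` times a
convergent quotient. -/
theorem HasDirDeriv.tendsto {F : Phase → Phase} {F' v w : Phase} (h : HasDirDeriv F F' v w) :
    Tendsto (fun t : ℝ => F (v + t • w)) (𝓝[≠] 0) (𝓝 (F v)) := by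
  have h0 : Tendsto (fun t : ℝ => t) (𝓝[≠] 0) (𝓝 0) := tendsto_nhdsWithin_of_tendsto_nhds tendsto_id
  have h1 := (h0.smul h).const_add (F v)
  rw [zero_smul, add_zero] at h1
  refine h1.congr' ?_
  filter_upwards [self_mem_nhdsWithin] with t ht
  rw [smul_inv_smul₀ ht, add_sub_cancel]

theorem HasDirDeriv.add {F G : Phase → Phase} {F' G' v w : Phase} (hF : HasDirDeriv F F' v w)
    (hG : HasDirDeriv G G' v w) : HasDirDeriv (fun q => F q + G q) (F' + G') v w := by
  refine (Tendsto.add hF hG).congr fun t => ?_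
  rw [← smul_add]
  congr 1
  dsimp only
  abel

theorem HasDirDeriv.sub {F G : Phase → Phase} {F' G' v w : Phase} (hF : HasDirDeriv F F' v w)
    (hG : HasDirDeriv G G' v w) : HasDirDeriv (fun q => F q - G q) (F' - G') v w := by
  refine (Tendsto.sub hF hG).congr fun t => ?_
  rw [← smul_sub]
  congr 1
  dsimp only
  abel

theorem hasDirDeriv_const (b v w : Phase) : HasDirDeriv (fun _ => b) 0 v w := by
  simp [HasDirDeriv]

theorem HasDirDeriv.twist {F : Phase → Phase} {F' v w : Phase} (L : ℂ →L[ℝ] ℝ)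
    (h : HasDirDeriv F F' v w) :
    HasDirDeriv (fun q => twist L q q (F q))
      (PeakonNLS.twist L w v (F v) + PeakonNLS.twist L v w (F v) + PeakonNLS.twist L v v F')
      v w := by
  have h0 : Tendsto (fun t : ℝ => t) (𝓝[≠] 0) (𝓝 0) := tendsto_nhdsWithin_of_tendsto_nhds tendsto_id
  have hT := h.tendsto
  have h1 := ((continuous_twist L w v).tendsto _).comp hT
  have h2 := ((continuous_twist L v w).tendsto _).comp hT
  have h3 := h0.smul (((continuous_twist L w w).tendsto _).comp hT)
  have h4 := ((continuous_twist L v v).tendsto _).comp h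
  -- Both outer slots hold `v + t w`, so the difference quotient expands exactly by trilinearity.
  -- The quadratic term `h3` keeps a factor `t` and vanishes in the limit; only continuity in the
  -- last slot is needed.
  have h5 := ((h1.add h2).add h4).add h3
  rw [zero_smul, add_zero] at h5
  refine h5.congr' ?_
  filter_upwards [self_mem_nhdsWithin] with t ht
  have ht' : t ≠ 0 := ht
  simp only [Function.comp_apply, twist_add₁, twist_add₂, twist_smul₁, twist_smul₂, twist_smul₃,
    twist_sub₃, smul_add, smul_sub, inv_smul_smul₀ ht']
  abel

theorem continuous_I_smul : Continuous fun f : Phase => Complex.I • f := continuous_const_smul _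

theorem hasDirDeriv_peakonR {F : Phase → Phase} {F' v w : Phase} (h : HasDirDeriv F F' v w) :
    HasDirDeriv (fun q => peakonR q (F q)) (peakonRDeriv v w (F v) + peakonR v F') v w := by
  have hK := h.clm_comp DeltaInv continuous_DeltaInv
  have h1 := (hK.twist Complex.reCLM).clm_comp Dx continuous_Dx
  have h2 := ((hK.clm_comp Dx continuous_Dx).twist Complex.imCLM).clm_comp
    (LinearMap.lsmul ℂ Phase Complex.I |>.restrictScalars ℝ) continuous_I_smul
  have h3 := h1.add h2
  convert! h3 using 1
  simp only [peakonRDeriv, peakonR_apply, map_add, LinearMap.restrictScalars_apply,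
    LinearMap.lsmul_apply, smul_add]
  abel

/-! ### The hereditary property -/

/-- The localising device: densities that differ by an exact derivative have primitives that differ
by a local function. -/
theorem antideriv_sub_eq {g h G : 𝓢(ℝ, ℝ)} (e : g - h = SchwartzMap.derivCLM ℝ ℝ G) (x : ℝ) :
    antideriv g x = antideriv h x + G x := by
  rw [← antideriv_derivCLM G, ← e, antideriv_sub]
  ring

/-- Green's identity: `Re(p̄q)` is symmetric in `p` and `q`, so only the second-derivative terms
survive. -/
theorem density_re_Delta_sub (p q : Phase) :
    density Complex.reCLM (Delta p) q - density Complex.reCLM (Delta q) p =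
      SchwartzMap.derivCLM ℝ ℝ
        (density Complex.reCLM p (Dx q) - density Complex.reCLM q (Dx p)) := by
  rw [map_sub, derivCLM_density, derivCLM_density]
  ext x
  simp [density_apply, Delta_apply]
  ring

theorem density_im_Delta_sub (p q : Phase) :
    density Complex.imCLM (Delta p) (Dx q) - density Complex.imCLM (Delta q) (Dx p) =
      SchwartzMap.derivCLM ℝ ℝ
        (density Complex.imCLM p q - density Complex.imCLM (Dx p) (Dx q)) := by
  rw [map_sub, derivCLM_density, derivCLM_density]
  ext x
  simp [density_apply, Delta_apply]
  ring

/-- `Δ⁻¹` of the antisymmetrised derivative of the peakon recursion operator. -/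
def bracket (v p q : Phase) : Phase :=
  twist Complex.reCLM (Dx p) v q - twist Complex.reCLM (Dx q) v p +
    Complex.I • (twist Complex.imCLM p v (Dx q) - twist Complex.imCLM q v (Dx p))

theorem Dx_bracket (v p q : Phase) :
    Dx (bracket v p q) = twist Complex.reCLM (Dx (Dx p)) v q - twist Complex.reCLM (Dx (Dx q)) v p +
      (triple Complex.reCLM (Dx p) v q - triple Complex.reCLM (Dx q) v p) +
      Complex.I • (twist Complex.imCLM (Dx p) v (Dx q) - twist Complex.imCLM (Dx q) v (Dx p)) +
      Complex.I • (triple Complex.imCLM p v (Dx q) - triple Complex.imCLM q v (Dx p)) := by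
  simp only [bracket, map_add, map_sub, Dx_complex_smul, Dx_twist, smul_sub, smul_add]
  abel

theorem peakonRDeriv_antisymm (v p q : Phase) :
    peakonRDeriv v (Delta p) (Delta q) - peakonRDeriv v (Delta q) (Delta p) =
      Delta (bracket v p q) := by
  have h1 : twist Complex.reCLM v (Delta p) q = twist Complex.reCLM v (Delta q) p +
      triple Complex.reCLM v p (Dx q) - triple Complex.reCLM v q (Dx p) := by
    ext x
    have := antideriv_sub_eq (density_re_Delta_sub p q) x
    simp only [twist_apply, this, triple_apply, add_apply, sub_apply, density_apply]
    push_cast; ring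
  have h2 : twist Complex.imCLM v (Delta p) (Dx q) = twist Complex.imCLM v (Delta q) (Dx p) +
      triple Complex.imCLM v p q - triple Complex.imCLM v (Dx p) (Dx q) := by
    ext x
    have := antideriv_sub_eq (density_im_Delta_sub p q) x
    simp only [twist_apply, this, triple_apply, add_apply, sub_apply, density_apply]
    push_cast; ring
  simp only [peakonRDeriv, DeltaInv_Delta, h1, h2, Delta_apply (bracket v p q), Dx_bracket]
  simp only [bracket, Delta_apply, map_add, map_sub, Dx_complex_smul, Dx_twist, Dx_triple]
  ext x
  simp only [twist_apply, triple_apply, add_apply, sub_apply, smul_apply, smul_eq_mul]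
  -- The surviving primitives all pair with `v` and act as real atoms, so a polynomial identity in
  -- real and imaginary parts remains.
  apply Complex.ext <;>
  · simp only [Complex.add_re, Complex.add_im, Complex.sub_re, Complex.sub_im, Complex.mul_re,
      Complex.mul_im, Complex.I_re, Complex.I_im, Complex.ofReal_re, Complex.ofReal_im,
      Complex.reCLM_apply, Complex.imCLM_apply, Complex.conj_re, Complex.conj_im]
    ring

theorem peakonR_Delta (v p : Phase) : peakonR v (Delta p) =
    twist Complex.reCLM (Dx v) v p + triple Complex.reCLM v v p +
      Complex.I • twist Complex.imCLM v v (Dx p) := by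
  rw [peakonR_apply, DeltaInv_Delta, Dx_twist]

theorem peakonR_Delta_apply (v p : Phase) (x : ℝ) : peakonR v (Delta p) x =
    antideriv (density Complex.reCLM v p) x * Dx v x + (conj (v x) * p x).re * v x +
      Complex.I * (antideriv (density Complex.imCLM v (Dx p)) x * v x) := by
  simp only [peakonR_Delta, add_apply, smul_apply, twist_apply, triple_apply, smul_eq_mul,
    Complex.reCLM_apply]

/-- Modulo an exact derivative, antisymmetrising the pairing with `R̃` yields the pairing of `v`
with the bracket; this moves the nested primitives onto `bracket`. -/
theorem density_re_peakonR (v p q : Phase) :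
    density Complex.reCLM (peakonR v (Delta p)) q -
        (density Complex.reCLM (peakonR v (Delta q)) p +
          density Complex.reCLM v (bracket v p q)) =
      SchwartzMap.derivCLM ℝ ℝ (density Complex.reCLM (twist Complex.reCLM v v p) q -
        density Complex.reCLM (twist Complex.reCLM v v q) p) := by
  rw [map_sub, derivCLM_density, derivCLM_density]
  ext x
  simp only [peakonR_Delta, bracket, Dx_twist, density_apply, twist_apply, triple_apply,
    add_apply, sub_apply, smul_apply, smul_eq_mul, map_add, map_mul, Complex.conj_I,
    Complex.conj_ofReal]
  simp
  ring

theorem density_im_peakonR (v p q : Phase) :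
    density Complex.imCLM (peakonR v (Delta p)) (Dx q) -
        (density Complex.imCLM (peakonR v (Delta q)) (Dx p) +
          density Complex.imCLM v (Dx (bracket v p q))) =
      SchwartzMap.derivCLM ℝ ℝ (density Complex.imCLM (twist Complex.reCLM v v p) (Dx q) -
        density Complex.imCLM (twist Complex.reCLM v v q) (Dx p)) := by
  rw [map_sub, derivCLM_density, derivCLM_density]
  ext x
  simp only [peakonR_Delta, Dx_bracket, Dx_twist, density_apply, twist_apply, triple_apply,
    add_apply, sub_apply, smul_apply, smul_eq_mul, map_add, map_mul, Complex.conj_I,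
    Complex.conj_ofReal]
  simp
  ring

theorem peakonRDeriv_peakonR_antisymm (v p q : Phase) :
    peakonRDeriv v (peakonR v (Delta p)) (Delta q) -
        peakonRDeriv v (peakonR v (Delta q)) (Delta p) =
      peakonR v (Delta (bracket v p q)) := by
  -- With `X` the difference of doubly nested twists, `h1` has the error `iX` and `h2` the error
  -- `-D_x X`. They cancel in `D_x(h1) + i(h2)`.
  have h1 : twist Complex.reCLM (peakonR v (Delta p)) v q +
        twist Complex.reCLM v (peakonR v (Delta p)) q -
        (twist Complex.reCLM (peakonR v (Delta q)) v p +
        twist Complex.reCLM v (peakonR v (Delta q)) p) =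
      twist Complex.reCLM v v (bracket v p q) +
      Complex.I • (twist Complex.reCLM (twist Complex.imCLM v v (Dx p)) v q -
        twist Complex.reCLM (twist Complex.imCLM v v (Dx q)) v p) := by
    ext x
    have := antideriv_sub_eq (density_re_peakonR v p q) x
    rw [antideriv_add] at this
    simp only [add_apply, sub_apply, smul_apply, smul_eq_mul, twist_apply, this,
      peakonR_Delta_apply, density_apply]
    simp
    ring
  have h2 : twist Complex.imCLM (peakonR v (Delta p)) v (Dx q) +
        twist Complex.imCLM v (peakonR v (Delta p)) (Dx q) -
        (twist Complex.imCLM (peakonR v (Delta q)) v (Dx p) +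
        twist Complex.imCLM v (peakonR v (Delta q)) (Dx p)) =
      twist Complex.imCLM v v (Dx (bracket v p q)) -
      Dx (twist Complex.reCLM (twist Complex.imCLM v v (Dx p)) v q -
        twist Complex.reCLM (twist Complex.imCLM v v (Dx q)) v p) := by
    ext x
    have := antideriv_sub_eq (density_im_peakonR v p q) x
    rw [antideriv_add] at this
    simp only [map_sub, Dx_twist, add_apply, sub_apply, twist_apply, this, peakonR_Delta_apply,
      triple_apply, density_apply]
    simp
    ring
  rw [peakonRDeriv, peakonRDeriv, DeltaInv_Delta, DeltaInv_Delta, peakonR_apply v (Delta (bracket v p q)),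
    DeltaInv_Delta, add_sub_add_comm, ← map_sub, ← smul_sub, h1, h2, map_add, Dx_complex_smul,
    smul_sub]
  abel

theorem peakonRDeriv_add (v c c' b : Phase) :
    peakonRDeriv v (c + c') b = peakonRDeriv v c b + peakonRDeriv v c' b := by
  simp only [peakonRDeriv, twist_add₁, twist_add₂, map_add, smul_add]
  abel

theorem peakonRDeriv_sub (v c c' b : Phase) :
    peakonRDeriv v (c - c') b = peakonRDeriv v c b - peakonRDeriv v c' b := by
  rw [eq_sub_iff_add_eq, ← peakonRDeriv_add, sub_add_cancel]

theorem hasDirDeriv_hatR {s : ℝ} (hs : s = 1 ∨ s = -1) {F : Phase → Phase} {F' v w : Phase}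
    (h : HasDirDeriv F F' v w) :
    HasDirDeriv (fun q => hatR s q (F q)) (peakonRDeriv v w (F v) + hatR s v F') v w := by
  simp only [hatR_apply hs]
  rw [← add_sub_assoc]
  exact (hasDirDeriv_peakonR h).sub h

/-- The vanishing of the Nijenhuis torsion of `R̂`. -/
theorem peakonRDeriv_hatR_symm {s : ℝ} (hs : s = 1 ∨ s = -1) (v a b : Phase) :
    peakonRDeriv v (hatR s v a) b - peakonRDeriv v (hatR s v b) a =
      hatR s v (peakonRDeriv v a b - peakonRDeriv v b a) := by
  rw [hatR_apply hs, hatR_apply hs, hatR_apply hs, peakonRDeriv_sub, peakonRDeriv_sub]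
  have h1 := peakonRDeriv_antisymm v (DeltaInv a) (DeltaInv b)
  have h2 := peakonRDeriv_peakonR_antisymm v (DeltaInv a) (DeltaInv b)
  rw [← h1] at h2
  simp only [Delta_DeltaInv] at h2
  rw [← h2]
  abel

theorem isHereditary_hatR {s : ℝ} (hs : s = 1 ∨ s = -1) : IsHereditary (hatR s) := by
  refine ⟨peakonRDeriv, fun v a w => ?_, fun η η' hη =>
    ⟨fun v w => peakonRDeriv v w (η v) + hatR s v (η' v w),
      fun v w => hasDirDeriv_hatR hs (hη v w), fun v w => ?_⟩⟩
  · simpa using hasDirDeriv_hatR hs (hasDirDeriv_const w v a)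
  · have h := peakonRDeriv_hatR_symm hs v (η v) w
    rw [map_sub, sub_eq_iff_eq_add] at h
    simp only [lieDeriv, map_add, map_sub, h]
    abel

/-! ### The peakon flows -/

theorem Delta_complex_smul (c : ℂ) (f : Phase) : Delta (c • f) = c • Delta f := by
  simp only [Delta_apply, Dx_complex_smul, smul_sub]

theorem twist_eq_of_density_eq {L : ℂ →L[ℝ] ℝ} {b f : Phase} {G : 𝓢(ℝ, ℝ)}
    (h : density L b f = SchwartzMap.derivCLM ℝ ℝ G) (a : Phase) (x : ℝ) :
    twist L a b f x = G x * a x := by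
  rw [twist_apply, h, antideriv_derivCLM]

theorem density_im_Delta_self (u : Phase) :
    density Complex.imCLM (Delta u) u =
      SchwartzMap.derivCLM ℝ ℝ (density Complex.imCLM u (Dx u)) := by
  rw [derivCLM_density]
  ext x
  simp [density_apply, Delta_apply]
  ring

theorem density_re_Delta_Dx (u : Phase) :
    density Complex.reCLM (Delta u) (Dx u) = SchwartzMap.derivCLM ℝ ℝ
      ((2⁻¹ : ℝ) • (density Complex.reCLM u u - density Complex.reCLM (Dx u) (Dx u))) := by
  rw [map_smul, map_sub, derivCLM_density, derivCLM_density]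
  ext x
  simp [density_apply, Delta_apply]
  ring

theorem density_im_Delta_Dx_Dx (u : Phase) :
    density Complex.imCLM (Delta u) (Dx (Dx u)) =
      SchwartzMap.derivCLM ℝ ℝ (density Complex.imCLM u (Dx u)) := by
  rw [derivCLM_density]
  ext x
  simp [density_apply, Delta_apply]
  ring

theorem density_im_eq_potB (u : Phase) (x : ℝ) :
    density Complex.imCLM u (Dx u) x = potB u x := density_apply _ _ _ _

theorem density_re_eq_potA (u : Phase) (x : ℝ) :
    ((2⁻¹ : ℝ) • (density Complex.reCLM u u - density Complex.reCLM (Dx u) (Dx u))) x =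
      potA u x := by
  rw [smul_apply, sub_apply, density_apply, density_apply, potA, Complex.conj_mul',
    Complex.conj_mul', ← Complex.ofReal_pow, ← Complex.ofReal_pow, Complex.reCLM_apply,
    Complex.reCLM_apply, Complex.ofReal_re, Complex.ofReal_re, smul_eq_mul]
  ring

theorem hatR_rootEven {s : ℝ} (hs : s = 1 ∨ s = -1) (u : Phase) (x : ℝ) :
    hatR s (Delta u) (rootEven s (Delta u)) x =
      evenPeakonFlow s u x - rootEven s (Delta u) x := by
  have h1 : twist Complex.reCLM (Delta u) (Delta u) (((s : ℂ) * Complex.I) • u) =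
      (-s) • twist Complex.imCLM (Delta u) (Delta u) u := by
    have : density Complex.reCLM (Delta u) (((s : ℂ) * Complex.I) • u) =
        (-s) • density Complex.imCLM (Delta u) u := by
      ext y; simp [density_apply]; ring
    ext y
    rw [twist_apply, this, antideriv_smul, smul_apply, twist_apply, Complex.real_smul]
    push_cast; ring
  have h2 : twist Complex.imCLM (Delta u) (Delta u) (((s : ℂ) * Complex.I) • Dx u) =
      s • twist Complex.reCLM (Delta u) (Delta u) (Dx u) := by
    have : density Complex.imCLM (Delta u) (((s : ℂ) * Complex.I) • Dx u) =
        s • density Complex.reCLM (Delta u) (Dx u) := by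
      ext y; simp [density_apply]; ring
    ext y
    rw [twist_apply, this, antideriv_smul, smul_apply, twist_apply, Complex.real_smul]
    push_cast; ring
  have h3 : (twist Complex.imCLM (Delta u) (Delta u) u : ℝ → ℂ) =
      fun y => (potB u y : ℂ) * Delta u y := by
    ext y
    rw [twist_eq_of_density_eq (density_im_Delta_self u), density_im_eq_potB]
  rw [hatR_apply hs, sub_apply, peakonR_apply, rootEven, ← Delta_complex_smul, DeltaInv_Delta,
    Dx_complex_smul, h1, h2, map_smul, add_apply, smul_apply, smul_apply, smul_apply, Dx_apply, h3,
    twist_eq_of_density_eq (density_re_Delta_Dx u), density_re_eq_potA, Complex.real_smul,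
    Complex.real_smul, smul_eq_mul, evenPeakonFlow]
  push_cast
  linear_combination (-(s : ℂ) * deriv (fun y => (potB u y : ℂ) * Delta u y) x) * Complex.I_sq

theorem hatR_rootOdd {s : ℝ} (hs : s = 1 ∨ s = -1) (u : Phase) (x : ℝ) :
    hatR s (Delta u) (rootOdd (Delta u)) x = oddPeakonFlow u x - rootOdd (Delta u) x := by
  have h0 : rootOdd (Delta u) = Delta (-Dx u) := by
    simp only [rootOdd, Delta_apply, map_sub, map_neg]
  have h : (twist Complex.reCLM (Delta u) (Delta u) (Dx u) : ℝ → ℂ) =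
      fun y => (potA u y : ℂ) * Delta u y := by
    ext y
    rw [twist_eq_of_density_eq (density_re_Delta_Dx u), density_re_eq_potA]
  have hneg : ∀ L f, twist L (Delta u) (Delta u) (-f) = -twist L (Delta u) (Delta u) f :=
    fun L f => map_neg (twistLin L (Delta u) (Delta u)) f
  rw [hatR_apply hs, sub_apply, peakonR_apply, h0, DeltaInv_Delta, map_neg Dx, hneg, hneg, map_neg,
    add_apply, neg_apply, smul_apply, neg_apply, Dx_apply, h,
    twist_eq_of_density_eq (density_im_Delta_Dx_Dx u), density_im_eq_potB, smul_eq_mul,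
    oddPeakonFlow]
  ring

/-! ### Phase rotation -/

/-- `A` and `B` are invariant under a constant phase, so the flow is equivariant. -/
theorem evenPeakonFlow_smul (s : ℝ) {c : ℂ} (hc : ‖c‖ = 1) (u : Phase) (x : ℝ) :
    evenPeakonFlow s (c • u) x = c * evenPeakonFlow s u x := by
  have hA : ∀ y, potA (c • u) y = potA u y := by
    intro y
    rw [potA, Dx_complex_smul, smul_apply, smul_apply, norm_smul, norm_smul, hc, one_mul, one_mul,
      potA]
  have hB : ∀ y, potB (c • u) y = potB u y := by
    intro y
    have h : conj c * c = 1 := by rw [Complex.conj_mul', hc]; simp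
    rw [potB, Dx_complex_smul, smul_apply, smul_apply, smul_eq_mul, smul_eq_mul, map_mul, potB]
    congr 1
    linear_combination (conj (u y) * Dx u y) * h
  have hd : deriv (fun y => (potB u y : ℂ) * (c * Delta u y)) x =
      c * deriv (fun y => (potB u y : ℂ) * Delta u y) x := by
    rw [← deriv_const_mul_field]
    congr 1
    ext y
    ring
  simp only [evenPeakonFlow, hA, hB, Delta_complex_smul, smul_apply, smul_eq_mul, hd]
  ring

/-- The term `k v` comes from differentiating the phase. Taking `k = -si` and `k = si` gives the two
directions of the equivalence. -/
theorem IsSolution.exp_smul {J : Set ℝ} {F F' : Phase → ℝ → ℂ} {u : ℝ → Phase} (k : ℂ)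
    (h : IsSolution J F u)
    (hF : ∀ (t : ℝ) w x,
      F' (Complex.exp (k * t) • w) x = Complex.exp (k * t) * (F w x + k * Delta w x)) :
    IsSolution J F' (fun t => Complex.exp (k * t) • u t) := by
  have he : ∀ t : ℝ, HasDerivAt (fun τ : ℝ => Complex.exp (k * τ)) (Complex.exp (k * t) * k) t := by
    intro t
    have h1 : HasDerivAt (fun τ : ℝ => k * (τ : ℂ)) k t := by
      simpa using (Complex.ofRealCLM.hasDerivAt (x := t)).const_mul k
    exact h1.cexp
  refine ⟨?_, fun t ht x => ?_⟩
  · simp only [Delta_complex_smul, smul_apply, smul_eq_mul]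
    have h1 : ContDiff ℝ 1 fun p : ℝ × ℝ => Complex.exp (k * (p.1 : ℂ)) :=
      (contDiff_const.mul (Complex.ofRealCLM.contDiff.comp contDiff_fst)).cexp
    exact h1.contDiffOn.mul h.1
  · simp only [Delta_complex_smul, smul_apply, smul_eq_mul, hF]
    convert! (he t).mul (h.2 t ht x) using 1
    ring

theorem isSolution_even_iff {s : ℝ} (hs : s = 1 ∨ s = -1) (J : Set ℝ) (u : ℝ → Phase) :
    IsSolution J (evenPeakonFlow s) u ↔
      IsSolution J (fun w => hatR s (Delta w) (rootEven s (Delta w)))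
        (fun t => Complex.exp (-((s : ℂ) * Complex.I * (t : ℂ))) • u t) := by
  have hn : ∀ (r t : ℝ), ‖Complex.exp ((r : ℂ) * Complex.I * t)‖ = 1 := by
    intro r t
    rw [show (r : ℂ) * Complex.I * t = ((r * t : ℝ) : ℂ) * Complex.I by push_cast; ring,
      Complex.norm_exp_ofReal_mul_I]
  have hr : ∀ w x, rootEven s (Delta w) x = (s : ℂ) * Complex.I * Delta w x := fun w x => rfl
  constructor
  · intro h
    have := h.exp_smul (F' := fun w => hatR s (Delta w) (rootEven s (Delta w)))
      (((-s : ℝ) : ℂ) * Complex.I) (fun t w x => by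
        rw [hatR_rootEven hs, hr, evenPeakonFlow_smul s (hn _ t), Delta_complex_smul, smul_apply,
          smul_eq_mul]
        push_cast
        ring)
    convert! this using 4
    push_cast
    ring
  · intro h
    have := h.exp_smul (F' := evenPeakonFlow s) ((s : ℂ) * Complex.I) (fun t w x => by
        rw [hatR_rootEven hs, hr, evenPeakonFlow_smul s (hn _ t)]
        ring)
    simpa [smul_smul, ← Complex.exp_add] using this

/-! ### Galilean transformation -/

theorem Dx_translate (a : ℝ) (f : Phase) :
    Dx (SchwartzMap.compSubConstCLM ℝ a f) = SchwartzMap.compSubConstCLM ℝ a (Dx f) := by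
  ext x
  exact deriv_comp_sub_const f a x

theorem Delta_translate (a : ℝ) (f : Phase) :
    Delta (SchwartzMap.compSubConstCLM ℝ a f) = SchwartzMap.compSubConstCLM ℝ a (Delta f) := by
  simp only [Delta_apply, Dx_translate, map_sub]

theorem oddPeakonFlow_translate (a : ℝ) (u : Phase) (x : ℝ) :
    oddPeakonFlow (SchwartzMap.compSubConstCLM ℝ a u) x = oddPeakonFlow u (x - a) := by
  simp only [oddPeakonFlow, potA, potB, Delta_translate, Dx_translate,
    SchwartzMap.compSubConstCLM_apply]
  rw [deriv_comp_sub_const (fun y => (((‖u y‖ ^ 2 - ‖Dx u y‖ ^ 2) / 2 : ℝ) : ℂ) * Delta u y)]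

theorem IsSolution.translate {J : Set ℝ} (hJ : IsOpen J) {F F' : Phase → ℝ → ℂ} {u : ℝ → Phase}
    (k : ℝ) (h : IsSolution J F u)
    (hF : ∀ (t : ℝ) w x, F' (SchwartzMap.compSubConstCLM ℝ (k * t) w) x =
      F w (x - k * t) - k * Dx (Delta w) (x - k * t)) :
    IsSolution J F' (fun t => SchwartzMap.compSubConstCLM ℝ (k * t) (u t)) := by
  refine ⟨?_, fun t ht x => ?_⟩
  · simp only [Delta_translate, SchwartzMap.compSubConstCLM_apply]
    have h1 : ContDiff ℝ 1 fun p : ℝ × ℝ => (p.1, p.2 - k * p.1) := by fun_prop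
    exact h.1.comp h1.contDiffOn fun p hp => ⟨hp.1, Set.mem_univ _⟩
  · simp only [Delta_translate, SchwartzMap.compSubConstCLM_apply, hF]
    -- Openness of `J` turns the joint `C¹` hypothesis into a full derivative at the point, as the
    -- chain rule along the moving line requires.
    have hd : HasFDerivAt (fun p : ℝ × ℝ => Delta (u p.1) p.2) _ (t, x - k * t) :=
      ((h.1.contDiffAt ((hJ.prod isOpen_univ).mem_nhds ⟨ht, Set.mem_univ _⟩)).differentiableAt
        one_ne_zero).hasFDerivAt
    set L := fderiv ℝ (fun p : ℝ × ℝ => Delta (u p.1) p.2) (t, x - k * t)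
    have h1 : L (1, 0) = F (u t) (x - k * t) :=
      (hd.comp_hasDerivAt t ((hasDerivAt_id t).prodMk (hasDerivAt_const t (x - k * t)))).unique
        (h.2 t ht _)
    have h2 : L (0, 1) = Dx (Delta (u t)) (x - k * t) :=
      (hd.comp_hasDerivAt (x - k * t)
        ((hasDerivAt_const (x - k * t) t).prodMk (hasDerivAt_id _))).unique
        ((Delta (u t)).hasDerivAt _)
    -- The velocity `(1, -k)` splits into the time derivative, given by the equation, and `-k` times
    -- the space derivative.
    have h3 : HasDerivAt (fun τ : ℝ => (τ, x - k * τ)) (1, -k) t :=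
      (hasDerivAt_id t).prodMk (by simpa using ((hasDerivAt_id t).const_mul k).const_sub x)
    have h4 := hd.comp_hasDerivAt t h3
    have e : ((1, -k) : ℝ × ℝ) = (1, 0) + (-k) • (0, 1) := by simp
    rw [e, map_add, map_smul, h1, h2, Complex.real_smul] at h4
    convert! h4 using 1
    push_cast
    ring

theorem isSolution_odd_iff {s : ℝ} (hs : s = 1 ∨ s = -1) {J : Set ℝ} (hJ : IsOpen J)
    (u : ℝ → Phase) :
    IsSolution J oddPeakonFlow u ↔
      IsSolution J (fun w => hatR s (Delta w) (rootOdd (Delta w)))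
        (fun t => SchwartzMap.compSubConstCLM ℝ (-t) (u t)) := by
  have hr : ∀ w x, rootOdd (Delta w) x = -Dx (Delta w) x := fun w x => rfl
  constructor
  · intro h
    have := h.translate hJ (F' := fun w => hatR s (Delta w) (rootOdd (Delta w))) (-1)
      (fun t w x => by
        rw [hatR_rootOdd hs, oddPeakonFlow_translate, hr, Delta_translate, Dx_translate,
          SchwartzMap.compSubConstCLM_apply]
        push_cast
        ring)
    simpa using this
  · intro h
    have := h.translate hJ (F' := oddPeakonFlow) 1 (fun t w x => by
        rw [hatR_rootOdd hs, oddPeakonFlow_translate, hr]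
        push_cast
        ring)
    simpa using this

end PeakonNLS
end

open PeakonNLS
theorem mainTheorem6 (s : ℝ) (hs : s = 1 ∨ s = -1) :
    (∀ v : Phase, -(nlsR s v ^ 2 + 1) = (peakonR v - 1) * Delta) ∧
    IsHereditary (hatR s) ∧
    (∀ (u : Phase) (x : ℝ),
      hatR s (Delta u) (rootEven s (Delta u)) x
        = evenPeakonFlow s u x - rootEven s (Delta u) x) ∧
    (∀ (u : Phase) (x : ℝ),
      hatR s (Delta u) (rootOdd (Delta u)) x = oddPeakonFlow u x - rootOdd (Delta u) x) ∧
    (∀ (J : Set ℝ), IsOpen J → ∀ u : ℝ → Phase,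
      (IsSolution J (evenPeakonFlow s) u ↔
        IsSolution J (fun w => hatR s (Delta w) (rootEven s (Delta w)))
          (fun t => Complex.exp (-((s : ℂ) * Complex.I * (t : ℂ))) • u t))) ∧
    (∀ (J : Set ℝ), IsOpen J → ∀ u : ℝ → Phase,
      (IsSolution J oddPeakonFlow u ↔
        IsSolution J (fun w => hatR s (Delta w) (rootOdd (Delta w)))
          (fun t => SchwartzMap.compSubConstCLM ℝ (-t) (u t)))) :=
  ⟨neg_nlsR_sq_add_one hs, isHereditary_hatR hs, hatR_rootEven hs, hatR_rootOdd hs,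
    fun J _ u => isSolution_even_iff hs J u, fun _ hJ u => isSolution_odd_iff hs hJ u⟩
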